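/- A $k$-class association scheme is a finite set $\mathcal{A}$ together with a partition $\mathcal{A}^2=\mathcal{A}_0\cup\dots\cup\mathcal{A}_k$ into nonempty classes such that $\mathcal{A}_0=\{(x,x):x\in\mathcal{A}\}$, $(x,y)\in\mathcal{A}_i$ if and only if $(y,x)\in\mathcal{A}_i$, and for all $\ell,m,n\in\{0,\dots,k\}$ and all $(x,y)\in\mathcal{A}_\ell$ the number of $z\in\mathcal{A}$ with $(x,z)\in\mathcal{A}_m$ and $(y,z)\in\mathcal{A}_n$ is a number $P_\ell(m,n)$ that depends only on $\ell,m,n$. The $P_\ell(m,n)$ are called the intersection numbers, the $P_0(m,m)$ the valencies, and $|\mathcal{A}|$ the size of the scheme. An isomorphism between two $k$-class association schemes is a bijection of the underlying sets that maps the $i$-th class onto the $i$-th class for each $i$. Let $E_8\subset\mathbb{R}^8$ be the lattice of all vectors whose coordinates are either all in $\mathbb{Z}$ or all in $\mathbb{Z}+\frac12$ and have an even integer as their sum, and let $\mathcal{C}$ be the set of its minimal vectors (its nonzero vectors of smallest length, $\sqrt2$). Theorem. Grouping the pairs $(x,y)\in\mathcal{C}^2$ according to their inner product $\langle x,y\rangle$,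 where the classes $0,1,2,3,4$ correspond to the inner products $2,1,0,-1,-2$, makes $\mathcal{C}$ a 4-class association scheme. Every 4-class association scheme with the same size, valencies and intersection numbers as this one is isomorphic to it. -/

import Mathlib

/-- A (symmetric) `k`-class association scheme on the finite set `X`. The partition of `X × X` into
the `k + 1` nonempty classes `𝒜₀, …, 𝒜ₖ` is given by the map `cls`: the pair `(x, y)` lies in
`𝒜ᵢ` iff `cls x y = i`. As every class is nonempty, the numbers `inter l m n` are determined
by `cls`. -/
structure AssociationScheme (k : ℕ) (X : Type*) where
  finite : Finite X
  cls : X → X → Fin (k + 1)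
  cls_nonempty : ∀ i, ∃ x y, cls x y = i
  cls_eq_zero_iff : ∀ x y, cls x y = 0 ↔ x = y
  cls_symm : ∀ x y, cls x y = cls y x
  /-- The intersection number `P_l(m, n)`. -/
  inter : Fin (k + 1) → Fin (k + 1) → Fin (k + 1) → ℕ
  ncard_eq_inter : ∀ l m n x y, cls x y = l →
    {z | cls x z = m ∧ cls y z = n}.ncard = inter l m n

namespace AssociationScheme

/-- The valency of the class `m`. -/
def valency {k : ℕ} {X : Type*} (A : AssociationScheme k X) (m : Fin (k + 1)) : ℕ :=
  A.inter 0 m m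

/-- Two association schemes have the same size, valencies and intersection numbers. -/
structure SameParameters {k : ℕ} {X Y : Type*}
    (A : AssociationScheme k X) (B : AssociationScheme k Y) : Prop where
  size_eq : Nat.card X = Nat.card Y
  valency_eq : ∀ m, A.valency m = B.valency m
  inter_eq : ∀ l m n, A.inter l m n = B.inter l m n

/-- Isomorphism: a bijection of the underlying sets that maps each class onto the class with the
same label. -/
def IsIsomorphic {k : ℕ} {X Y : Type*}
    (A : AssociationScheme k X) (B : AssociationScheme k Y) : Prop :=
  ∃ f : X ≃ Y, ∀ x y, B.cls (f x) (f y) = A.cls x y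

end AssociationScheme

/-- The `E₈` lattice: the vectors of `ℝ⁸` whose coordinates are all integers or all
half-odd-integers and whose coordinate sum is an even integer. -/
def E8Lattice : AddSubgroup (EuclideanSpace ℝ (Fin 8)) where
  carrier := {x | ((∀ i, ∃ n : ℤ, x i = n) ∨ (∀ i, ∃ n : ℤ, x i = n + 1 / 2)) ∧
    ∃ m : ℤ, ∑ i, x i = 2 * m}
  zero_mem' := ⟨Or.inl fun _ => ⟨0, by simp⟩, 0, by simp⟩
  add_mem' := by
    rintro x y ⟨hx, a, ha⟩ ⟨hy, b, hb⟩
    refine ⟨?_, a + b, ?_⟩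
    · rcases hx with hx | hx <;> rcases hy with hy | hy
      · refine Or.inl fun i => ?_
        obtain ⟨p, hp⟩ := hx i
        obtain ⟨q, hq⟩ := hy i
        exact ⟨p + q, by simp [hp, hq]⟩
      · refine Or.inr fun i => ?_
        obtain ⟨p, hp⟩ := hx i
        obtain ⟨q, hq⟩ := hy i
        exact ⟨p + q, by simp [hp, hq]; ring⟩
      · refine Or.inr fun i => ?_
        obtain ⟨p, hp⟩ := hx i
        obtain ⟨q, hq⟩ := hy i
        exact ⟨p + q, by simp [hp, hq]; ring⟩
      · refine Or.inl fun i => ?_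
        obtain ⟨p, hp⟩ := hx i
        obtain ⟨q, hq⟩ := hy i
        exact ⟨p + q + 1, by simp [hp, hq]; ring⟩
    · simp only [PiLp.add_apply, Finset.sum_add_distrib, ha, hb]
      push_cast
      ring
  neg_mem' := by
    rintro x ⟨hx, a, ha⟩
    refine ⟨?_, -a, ?_⟩
    · rcases hx with hx | hx
      · refine Or.inl fun i => ?_
        obtain ⟨p, hp⟩ := hx i
        exact ⟨-p, by simp [hp]⟩
      · refine Or.inr fun i => ?_
        obtain ⟨p, hp⟩ := hx i
        exact ⟨-p - 1, by simp [hp]; ring⟩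
    · simp only [PiLp.neg_apply, Finset.sum_neg_distrib, ha]
      push_cast
      ring

/-- The minimal vectors of the `E₈` lattice: its nonzero vectors of smallest length. -/
def E8MinimalVectors : Set (EuclideanSpace ℝ (Fin 8)) :=
  {v | v ∈ E8Lattice ∧ v ≠ 0 ∧ ∀ w ∈ E8Lattice, w ≠ 0 → ‖v‖ ≤ ‖w‖}

/-- The inner products that occur between minimal vectors of `E₈` (which have norm `√2`), in the
order in which the classes are numbered. -/
def E8InnerProduct : Fin 5 → ℝ := ![2, 1, 0, -1, -2]

/-- `E` is the association scheme of minimal vectors of `E₈`: pairs of minimal vectors are grouped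
according to their inner product. -/
def IsE8Scheme (E : AssociationScheme 4 E8MinimalVectors) : Prop :=
  ∀ x y : E8MinimalVectors,
    inner ℝ (x : EuclideanSpace ℝ (Fin 8)) (y : EuclideanSpace ℝ (Fin 8)) =
      E8InnerProduct (E.cls x y)

/-! ### The lattice and its minimal vectors -/

/-! The scheme axioms follow from moment identities. The minimal vectors are invariant under
coordinate permutations, even sign changes, negation and reflections. Hence sums over z of ⟨x,z⟩^i
⟨y,z⟩^j with i, j ≤ 2 depend only on ⟨x,x⟩, ⟨y,y⟩ and ⟨x,y⟩ (`sum_inner_mul_inner`,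
`sum_inner_sq_mul_inner_sq`, `sum_inner_pow_odd`). On the five possible inner products, the
indicator of one value is a quadratic polynomial corrected at 2 and -2, and these values occur only
for z = x and z = -x. So each intersection count is a function of ⟨x,y⟩ (`sum_quasiQuadratic`).

For uniqueness, replace the classes of a scheme with these parameters by inner products, giving a
matrix G. The entries of G² are determined by intersection numbers, so G² = cG as for E₈, and G is
the Gram matrix of a tight frame. Its trace is 8c, so the frame spans eight dimensions
(`inner_eq_sum_of_tight_frame`). The parameters also give orthogonal u, w and fourteen z with ⟨u +
w, z⟩ = 2. With a = (u + w)/2, the vectors z - a are unit vectors orthogonal to a with mutual inner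
products 0 or ±1, so seven of them together with a form an orthonormal basis
(`exists_orthonormal_frame`). In it each vector has all coordinates integral or all half-odd, and at
most one sign change puts the whole system inside the E₈ minimal vectors (`exists_scaleLast_mem`).
Equality of sizes makes this embedding a bijection. -/

theorem inner_eq_sum_mul {ι : Type*} [Fintype ι] (x y : EuclideanSpace ℝ ι) :
    inner ℝ x y = ∑ i, x i * y i := by
  simp [PiLp.inner_apply, mul_comm]

theorem inner_int_of_mem_E8Lattice {x y : EuclideanSpace ℝ (Fin 8)} (hx : x ∈ E8Lattice)
    (hy : y ∈ E8Lattice) : ∃ n : ℤ, inner ℝ x y = n := by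
  obtain ⟨hx | hx, a, ha⟩ := hx <;> obtain ⟨hy | hy, b, hb⟩ := hy <;> choose p hp using hx <;>
    choose q hq using hy <;> rw [inner_eq_sum_mul] <;> simp only [hp, hq] at ha hb ⊢
  · exact ⟨∑ i, p i * q i, by push_cast; rfl⟩
  · refine ⟨∑ i, p i * q i + a, ?_⟩
    simp only [mul_add, Finset.sum_add_distrib, ← Finset.sum_mul, ha]
    push_cast
    ring
  · refine ⟨∑ i, p i * q i + b, ?_⟩
    simp only [add_mul, Finset.sum_add_distrib, ← Finset.mul_sum, hb]
    push_cast
    ring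
  -- Here ∑ p = 2a - 4 and ∑ q = 2b - 4, and the eight products 1/2 · 1/2 contribute 2.
  · refine ⟨∑ i, p i * q i + a + b - 2, ?_⟩
    simp only [Finset.sum_add_distrib, Finset.sum_const, Finset.card_univ, Fintype.card_fin,
      nsmul_eq_mul] at ha hb
    have h : ∀ i, ((p i : ℝ) + 1 / 2) * (q i + 1 / 2) =
        p i * q i + p i * (1 / 2) + q i * (1 / 2) + 1 / 4 := fun i => by ring
    simp only [h, Finset.sum_add_distrib, ← Finset.sum_mul, Finset.sum_const, Finset.card_univ,
      Fintype.card_fin, nsmul_eq_mul]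
    push_cast at *
    linarith

theorem even_sum_sq_sub_sum {ι : Type*} (s : Finset ι) (p : ι → ℤ) :
    Even (∑ i ∈ s, p i ^ 2 - ∑ i ∈ s, p i) := by
  rw [← Finset.sum_sub_distrib]
  refine Finset.even_sum _ fun i _ => ?_
  rw [show p i ^ 2 - p i = (p i - 1) * (p i - 1 + 1) by ring]
  exact Int.even_mul_succ_self _

theorem inner_self_even_of_mem_E8Lattice {x : EuclideanSpace ℝ (Fin 8)} (hx : x ∈ E8Lattice) :
    ∃ n : ℤ, inner ℝ x x = 2 * n := by
  obtain ⟨hx | hx, a, ha⟩ := hx <;> choose p hp using hx <;> rw [inner_eq_sum_mul] <;>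
    simp only [hp] at ha ⊢
  · obtain ⟨k, hk⟩ := even_sum_sq_sub_sum Finset.univ p
    refine ⟨k + a, ?_⟩
    have hk' := congrArg (Int.cast : ℤ → ℝ) hk
    push_cast at hk' ⊢
    simp only [← sq]
    linarith
  · obtain ⟨k, hk⟩ := even_sum_sq_sub_sum Finset.univ p
    refine ⟨k + 2 * a - 3, ?_⟩
    have hk' := congrArg (Int.cast : ℤ → ℝ) hk
    have h : ∀ i, ((p i : ℝ) + 1 / 2) * (p i + 1 / 2) = p i ^ 2 + p i + 1 / 4 := fun i => by ring
    simp only [h, Finset.sum_add_distrib, Finset.sum_const, Finset.card_univ,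
      Fintype.card_fin, nsmul_eq_mul] at ha ⊢
    push_cast at *
    linarith

/-- The vector `s eᵢ + t eⱼ`. -/
noncomputable def pairVector (i j : Fin 8) (s t : ℝ) : EuclideanSpace ℝ (Fin 8) :=
  EuclideanSpace.single i s + EuclideanSpace.single j t

theorem inner_pairVector (x : EuclideanSpace ℝ (Fin 8)) (i j : Fin 8) (s t : ℝ) :
    inner ℝ x (pairVector i j s t) = x i * s + x j * t := by
  simp [pairVector, inner_add_right, EuclideanSpace.inner_single_right, mul_comm]

theorem pairVector_apply (i j k : Fin 8) (s t : ℝ) :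
    pairVector i j s t k = (if k = i then s else 0) + (if k = j then t else 0) := by
  simp [pairVector]

theorem pairVector_mem_lattice (i j : Fin 8) (s t : ℤ) (h : Even (s + t)) :
    pairVector i j s t ∈ E8Lattice := by
  obtain ⟨m, hm⟩ := h
  refine ⟨Or.inl fun k => ⟨(if k = i then s else 0) + (if k = j then t else 0), ?_⟩, m, ?_⟩
  · rw [pairVector_apply]
    push_cast
    rfl
  · simp only [pairVector_apply, Finset.sum_add_distrib, Finset.sum_ite_eq', Finset.mem_univ,
      if_true]
    have := congrArg (Int.cast : ℤ → ℝ) hm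
    push_cast at this
    linarith

theorem inner_pairVector_self {i j : Fin 8} (hij : i ≠ j) (s t : ℝ) :
    inner ℝ (pairVector i j s t) (pairVector i j s t) = s ^ 2 + t ^ 2 := by
  rw [inner_pairVector]
  simp [pairVector_apply, hij, hij.symm, sq]

/-- Squared lengths in the lattice are even, so a nonzero one is at least 2, and e₀ + e₁ attains 2.
-/
theorem mem_E8MinimalVectors_iff {v : EuclideanSpace ℝ (Fin 8)} :
    v ∈ E8MinimalVectors ↔ v ∈ E8Lattice ∧ inner ℝ v v = 2 := by
  have key : ∀ w ∈ E8Lattice, w ≠ 0 → 2 ≤ inner ℝ w w := by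
    intro w hw h0
    obtain ⟨n, hn⟩ := inner_self_even_of_mem_E8Lattice hw
    have hpos : 0 < inner ℝ w w := real_inner_self_pos.2 h0
    have : 0 < n := by
      have : (0 : ℝ) < n := by linarith
      exact_mod_cast this
    have : (1 : ℝ) ≤ n := by exact_mod_cast this
    linarith
  constructor
  · rintro ⟨h, h0, hmin⟩
    refine ⟨h, le_antisymm ?_ (key v h h0)⟩
    have hself := inner_pairVector_self (show (0 : Fin 8) ≠ 1 by decide) ((1 : ℤ) : ℝ) ((1 : ℤ) : ℝ)
    have hne : pairVector 0 1 ((1 : ℤ) : ℝ) ((1 : ℤ) : ℝ) ≠ 0 := by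
      intro h
      rw [h] at hself
      norm_num at hself
    have hle := hmin _ (pairVector_mem_lattice 0 1 1 1 (by decide)) hne
    have := mul_self_le_mul_self (norm_nonneg _) hle
    rw [← real_inner_self_eq_norm_mul_norm, ← real_inner_self_eq_norm_mul_norm, hself] at this
    exact this.trans_eq (by norm_num)
  · rintro ⟨h, h2⟩
    refine ⟨h, fun h0 => ?_, fun w hw hw0 => ?_⟩
    · rw [h0] at h2
      norm_num at h2
    · refine le_of_sq_le_sq ?_ (norm_nonneg _)
      rw [← real_inner_self_eq_norm_sq, ← real_inner_self_eq_norm_sq, h2]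
      exact key w hw hw0

theorem pairVector_mem {i j : Fin 8} (hij : i ≠ j) {s t : ℤ} (hs : s ^ 2 = 1) (ht : t ^ 2 = 1) :
    pairVector i j s t ∈ E8MinimalVectors := by
  refine mem_E8MinimalVectors_iff.2 ⟨pairVector_mem_lattice i j s t ?_, ?_⟩
  · rcases sq_eq_one_iff.1 hs with rfl | rfl <;> rcases sq_eq_one_iff.1 ht with rfl | rfl <;>
      decide
  · rw [inner_pairVector_self hij]
    exact_mod_cast show s ^ 2 + t ^ 2 = 2 by omega

theorem finite_E8MinimalVectors : E8MinimalVectors.Finite := by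
  refine (Set.finite_range fun n : Fin 8 → Finset.Icc (-3 : ℤ) 3 =>
    (WithLp.toLp 2 fun i => ((n i : ℤ) : ℝ) / 2 : EuclideanSpace ℝ (Fin 8))).subset fun x hx => ?_
  obtain ⟨hL, h2⟩ := mem_E8MinimalVectors_iff.1 hx
  have hint : ∀ i, ∃ n : ℤ, 2 * x i = n := by
    obtain ⟨h | h, -⟩ := hL <;> intro i <;> obtain ⟨n, hn⟩ := h i
    · exact ⟨2 * n, by rw [hn]; push_cast; ring⟩
    · exact ⟨2 * n + 1, by rw [hn]; push_cast; ring⟩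
  choose n hn using hint
  have hb : ∀ i, n i ∈ Finset.Icc (-3 : ℤ) 3 := by
    intro i
    have h1 : x i * x i ≤ 2 := by
      rw [← h2, inner_eq_sum_mul]
      exact Finset.single_le_sum (f := fun i => x i * x i) (fun i _ => mul_self_nonneg _)
        (Finset.mem_univ i)
    have h3 : n i * n i ≤ 8 := by
      have : (n i : ℝ) * n i ≤ 8 := by rw [← hn]; nlinarith
      exact_mod_cast this
    rw [Finset.mem_Icc]
    constructor <;> nlinarith
  refine ⟨fun i => ⟨n i, hb i⟩, ?_⟩
  ext i
  simp [← hn i]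

theorem inner_self_of_mem {x : EuclideanSpace ℝ (Fin 8)} (hx : x ∈ E8MinimalVectors) :
    inner ℝ x x = 2 := (mem_E8MinimalVectors_iff.1 hx).2

theorem neg_mem_E8MinimalVectors {x : EuclideanSpace ℝ (Fin 8)} (hx : x ∈ E8MinimalVectors) :
    -x ∈ E8MinimalVectors := by
  rw [mem_E8MinimalVectors_iff] at hx ⊢
  exact ⟨neg_mem hx.1, by rw [inner_neg_neg, hx.2]⟩

theorem eq_of_inner_eq_two {V : Type*} [NormedAddCommGroup V] [InnerProductSpace ℝ V] {x y : V}
    (hx : inner ℝ x x = 2) (hy : inner ℝ y y = 2) (h : inner ℝ x y = 2) : x = y := by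
  rw [← sub_eq_zero, ← inner_self_eq_zero (𝕜 := ℝ), inner_sub_sub_self, hx, hy, real_inner_comm x y, h]
  norm_num

theorem exists_E8InnerProduct {x y : EuclideanSpace ℝ (Fin 8)} (hx : x ∈ E8MinimalVectors)
    (hy : y ∈ E8MinimalVectors) : ∃ i, inner ℝ x y = E8InnerProduct i := by
  obtain ⟨n, hn⟩ := inner_int_of_mem_E8Lattice (mem_E8MinimalVectors_iff.1 hx).1
    (mem_E8MinimalVectors_iff.1 hy).1
  have h := real_inner_mul_inner_self_le x y
  rw [inner_self_of_mem hx, inner_self_of_mem hy, hn] at h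
  have h' : n * n ≤ 2 * 2 := by exact_mod_cast h
  have h1 : -2 ≤ n := by nlinarith
  have h2 : n ≤ 2 := by nlinarith
  rw [hn]
  interval_cases n
  · exact ⟨4, by simp [E8InnerProduct]⟩
  · exact ⟨3, by simp [E8InnerProduct]⟩
  · exact ⟨2, by simp [E8InnerProduct]⟩
  · exact ⟨1, by simp [E8InnerProduct]⟩
  · exact ⟨0, by simp [E8InnerProduct]⟩

theorem E8InnerProduct_injective : Function.Injective E8InnerProduct := by
  intro i j h
  fin_cases i <;> fin_cases j <;> first | rfl | (simp [E8InnerProduct] at h; try norm_num at h)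

/-! ### Moments of the minimal vectors -/

/-- The finite set of minimal vectors. -/
noncomputable def E8Roots : Finset (EuclideanSpace ℝ (Fin 8)) := finite_E8MinimalVectors.toFinset

theorem mem_E8Roots {x : EuclideanSpace ℝ (Fin 8)} : x ∈ E8Roots ↔ x ∈ E8MinimalVectors := by
  simp [E8Roots]

theorem sum_E8Roots_comp (g h : EuclideanSpace ℝ (Fin 8) → EuclideanSpace ℝ (Fin 8))
    (hg : ∀ x ∈ E8MinimalVectors, g x ∈ E8MinimalVectors)
    (hh : ∀ x ∈ E8MinimalVectors, h x ∈ E8MinimalVectors)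
    (hgh : ∀ x, g (h x) = x) (hhg : ∀ x, h (g x) = x) (f : EuclideanSpace ℝ (Fin 8) → ℝ) :
    ∑ z ∈ E8Roots, f (g z) = ∑ z ∈ E8Roots, f z :=
  Finset.sum_nbij' g h (fun x hx => mem_E8Roots.2 (hg x (mem_E8Roots.1 hx)))
    (fun x hx => mem_E8Roots.2 (hh x (mem_E8Roots.1 hx))) (fun x _ => hhg x) (fun x _ => hgh x)
    fun _ _ => rfl

/-- Permutation of the coordinates. -/
def permuteCoords (π : Equiv.Perm (Fin 8)) (x : EuclideanSpace ℝ (Fin 8)) :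
    EuclideanSpace ℝ (Fin 8) := WithLp.toLp 2 fun i => x (π i)

theorem permuteCoords_mem (π : Equiv.Perm (Fin 8)) {x : EuclideanSpace ℝ (Fin 8)}
    (hx : x ∈ E8MinimalVectors) : permuteCoords π x ∈ E8MinimalVectors := by
  rw [mem_E8MinimalVectors_iff] at hx ⊢
  obtain ⟨⟨h, m, hm⟩, h2⟩ := hx
  refine ⟨⟨h.imp (fun h i => h (π i)) (fun h i => h (π i)), m, ?_⟩, ?_⟩
  · rw [← hm]
    exact Equiv.sum_comp π fun i => x i
  · rw [← h2, inner_eq_sum_mul, inner_eq_sum_mul]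
    exact Equiv.sum_comp π fun i => x i * x i

theorem sum_E8Roots_permute (π : Equiv.Perm (Fin 8)) (f : EuclideanSpace ℝ (Fin 8) → ℝ) :
    ∑ z ∈ E8Roots, f (permuteCoords π z) = ∑ z ∈ E8Roots, f z :=
  sum_E8Roots_comp _ (permuteCoords π.symm) (fun _ => permuteCoords_mem π)
    (fun _ => permuteCoords_mem _) (fun x => by ext i; simp [permuteCoords])
    (fun x => by ext i; simp [permuteCoords]) f

/-- Change of the signs of the coordinates `i` and `j`. -/
def flipCoords (i j : Fin 8) (x : EuclideanSpace ℝ (Fin 8)) : EuclideanSpace ℝ (Fin 8) :=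
  WithLp.toLp 2 fun k => if k = i ∨ k = j then -x k else x k

theorem flipCoords_apply (i j k : Fin 8) (x : EuclideanSpace ℝ (Fin 8)) :
    flipCoords i j x k = if k = i ∨ k = j then -x k else x k := rfl

theorem flipCoords_mem {i j : Fin 8} (hij : i ≠ j) {x : EuclideanSpace ℝ (Fin 8)}
    (hx : x ∈ E8MinimalVectors) : flipCoords i j x ∈ E8MinimalVectors := by
  rw [mem_E8MinimalVectors_iff] at hx ⊢
  obtain ⟨hL, h2⟩ := hx
  -- The flip subtracts a lattice vector: 2xᵢ and 2xⱼ are integers of the same parity.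
  have hflip : flipCoords i j x = x - pairVector i j (2 * x i) (2 * x j) := by
    ext k
    by_cases h1 : k = i
    · subst h1
      simp [flipCoords_apply, pairVector_apply, hij]
      ring
    · by_cases h3 : k = j
      · subst h3
        simp [flipCoords_apply, pairVector_apply, h1]
        ring
      · simp [flipCoords_apply, pairVector_apply, h1, h3]
  refine ⟨?_, ?_⟩
  · rw [hflip]
    refine sub_mem hL ?_
    obtain ⟨h | h, -⟩ := hL
    · obtain ⟨a, ha⟩ := h i
      obtain ⟨b, hb⟩ := h j
      have := pairVector_mem_lattice i j (2 * a) (2 * b) ⟨a + b, by ring⟩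
      rw [ha, hb]
      exact_mod_cast this
    · obtain ⟨a, ha⟩ := h i
      obtain ⟨b, hb⟩ := h j
      have := pairVector_mem_lattice i j (2 * a + 1) (2 * b + 1)
        ⟨a + b + 1, by ring⟩
      rw [ha, hb]
      convert this using 1
      push_cast
      congr 1 <;> ring
  · rw [← h2, inner_eq_sum_mul, inner_eq_sum_mul]
    refine Finset.sum_congr rfl fun k _ => ?_
    rw [flipCoords_apply]
    split_ifs <;> ring

theorem sum_E8Roots_flip {i j : Fin 8} (hij : i ≠ j) (f : EuclideanSpace ℝ (Fin 8) → ℝ) :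
    ∑ z ∈ E8Roots, f (flipCoords i j z) = ∑ z ∈ E8Roots, f z :=
  have hinv : ∀ x, flipCoords i j (flipCoords i j x) = x := fun x => by
    ext k
    simp only [flipCoords_apply]
    split_ifs <;> simp
  sum_E8Roots_comp _ (flipCoords i j) (fun _ => flipCoords_mem hij)
    (fun _ => flipCoords_mem hij) hinv hinv f

theorem sum_E8Roots_neg (f : EuclideanSpace ℝ (Fin 8) → ℝ) :
    ∑ z ∈ E8Roots, f (-z) = ∑ z ∈ E8Roots, f z :=
  sum_E8Roots_comp _ (fun x => -x) (fun _ => neg_mem_E8MinimalVectors)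
    (fun _ => neg_mem_E8MinimalVectors) neg_neg neg_neg f

/-- Reflection in the hyperplane orthogonal to a vector of norm `√2`. -/
noncomputable def rootReflection (r x : EuclideanSpace ℝ (Fin 8)) : EuclideanSpace ℝ (Fin 8) :=
  x - (inner ℝ x r : ℝ) • r

theorem inner_rootReflection {r : EuclideanSpace ℝ (Fin 8)} (x y : EuclideanSpace ℝ (Fin 8)) :
    inner ℝ x (rootReflection r y) = inner ℝ (rootReflection r x) y := by
  simp only [rootReflection, inner_sub_left, inner_sub_right, inner_smul_left, inner_smul_right]
  rw [real_inner_comm y r]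
  simp [mul_comm]

theorem rootReflection_rootReflection {r : EuclideanSpace ℝ (Fin 8)} (hr : inner ℝ r r = 2)
    (x : EuclideanSpace ℝ (Fin 8)) : rootReflection r (rootReflection r x) = x := by
  have : inner ℝ (rootReflection r x) r = -inner ℝ x r := by
    simp only [rootReflection, inner_sub_left, inner_smul_left, hr]
    simp only [conj_trivial]
    ring
  rw [rootReflection, this, rootReflection]
  module

theorem rootReflection_mem {r x : EuclideanSpace ℝ (Fin 8)} (hr : r ∈ E8MinimalVectors)
    (hx : x ∈ E8MinimalVectors) : rootReflection r x ∈ E8MinimalVectors := by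
  rw [mem_E8MinimalVectors_iff] at *
  refine ⟨?_, ?_⟩
  · obtain ⟨n, hn⟩ := inner_int_of_mem_E8Lattice hx.1 hr.1
    rw [rootReflection, hn]
    refine sub_mem hx.1 ?_
    rw [Int.cast_smul_eq_zsmul]
    exact zsmul_mem hr.1 n
  · rw [inner_rootReflection, rootReflection_rootReflection hr.2, hx.2]

theorem sum_E8Roots_rootReflection {r : EuclideanSpace ℝ (Fin 8)} (hr : r ∈ E8MinimalVectors)
    (f : EuclideanSpace ℝ (Fin 8) → ℝ) :
    ∑ z ∈ E8Roots, f (rootReflection r z) = ∑ z ∈ E8Roots, f z :=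
  sum_E8Roots_comp _ (rootReflection r) (fun _ => rootReflection_mem hr)
    (fun _ => rootReflection_mem hr)
    (rootReflection_rootReflection (inner_self_of_mem hr))
    (rootReflection_rootReflection (inner_self_of_mem hr)) f

theorem exists_perm_eq_eq {a b : Fin 8} (hab : a ≠ b) :
    ∃ π : Equiv.Perm (Fin 8), π 0 = a ∧ π 1 = b := by
  refine ⟨Equiv.swap 0 a * Equiv.swap 1 (Equiv.swap 0 a b), ?_, ?_⟩
  · have h : (0 : Fin 8) ≠ Equiv.swap 0 a b := fun h => hab (by
      simpa using congrArg (Equiv.swap 0 a) h)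
    rw [Equiv.Perm.mul_apply, Equiv.swap_apply_of_ne_of_ne (by decide : (0 : Fin 8) ≠ 1) h,
      Equiv.swap_apply_left]
  · simp

/-- Flipping the signs at a and at a third index negates the summand. Signs are flipped in pairs to
stay in the lattice. -/
theorem sum_mul_eq_zero {a b : Fin 8} (hab : a ≠ b) : ∑ z ∈ E8Roots, z a * z b = 0 := by
  obtain ⟨e, hea, heb⟩ : ∃ e : Fin 8, a ≠ e ∧ b ≠ e := by decide +revert
  have h := sum_E8Roots_flip hea fun z => z a * z b
  simp only [flipCoords_apply, hab.symm, heb, or_self, true_or, if_true, if_false, neg_mul,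
    Finset.sum_neg_distrib] at h
  linarith

theorem sum_mul_self_eq (a : Fin 8) :
    ∑ z ∈ E8Roots, z a * z a = ∑ z ∈ E8Roots, z 0 * z 0 := by
  have h := sum_E8Roots_permute (Equiv.swap 0 a) fun z => z 0 * z 0
  simpa [permuteCoords] using h

theorem exists_ne_four (a b c d : Fin 8) : ∃ e, a ≠ e ∧ b ≠ e ∧ c ≠ e ∧ d ≠ e := by
  have : ∃ e, e ∉ ({a, b, c, d} : Finset (Fin 8)) := by
    by_contra! h
    have h1 : Finset.univ ⊆ ({a, b, c, d} : Finset (Fin 8)) := fun e _ => h e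
    have := (Finset.card_le_card h1).trans Finset.card_le_four
    simp at this
  obtain ⟨e, he⟩ := this
  simp only [Finset.mem_insert, Finset.mem_singleton, not_or] at he
  exact ⟨e, Ne.symm he.1, Ne.symm he.2.1, Ne.symm he.2.2.1, Ne.symm he.2.2.2⟩

theorem sum_mul_four_eq_zero {a b c d : Fin 8} (hb : b ≠ a) (hc : c ≠ a) (hd : d ≠ a) :
    ∑ z ∈ E8Roots, z a * z b * (z c * z d) = 0 := by
  obtain ⟨e, hea, heb, hec, hed⟩ := exists_ne_four a b c d
  have h := sum_E8Roots_flip hea fun z => z a * z b * (z c * z d)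
  simp only [flipCoords_apply, hb, hc, hd, heb, hec, hed, or_self, true_or, if_true, if_false,
    neg_mul, Finset.sum_neg_distrib] at h
  linarith

theorem sum_sq_sq_eq {a b : Fin 8} (hab : a ≠ b) : ∑ z ∈ E8Roots, z a * z a * (z b * z b) =
    ∑ z ∈ E8Roots, z 0 * z 0 * (z 1 * z 1) := by
  obtain ⟨π, rfl, rfl⟩ := exists_perm_eq_eq hab
  exact sum_E8Roots_permute π fun z => z 0 * z 0 * (z 1 * z 1)

theorem sum_fourth_eq (a : Fin 8) : ∑ z ∈ E8Roots, z a * z a * (z a * z a) =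
    ∑ z ∈ E8Roots, z 0 * z 0 * (z 0 * z 0) := by
  have h := sum_E8Roots_permute (Equiv.swap 0 a) fun z => z 0 * z 0 * (z 0 * z 0)
  simpa [permuteCoords] using h

theorem sum_inner_mul_inner (x y : EuclideanSpace ℝ (Fin 8)) :
    ∑ z ∈ E8Roots, inner ℝ x z * inner ℝ y z =
      (∑ z ∈ E8Roots, z 0 * z 0) * inner ℝ x y := by
  rw [inner_eq_sum_mul x y, Finset.mul_sum]
  simp only [inner_eq_sum_mul, Finset.sum_mul_sum]
  rw [Finset.sum_comm]
  refine Finset.sum_congr rfl fun a _ => ?_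
  rw [Finset.sum_comm, Finset.sum_eq_single a]
  · rw [← sum_mul_self_eq a, Finset.sum_mul]
    exact Finset.sum_congr rfl fun z _ => by ring
  · intro b _ hb
    have : ∀ z : EuclideanSpace ℝ (Fin 8), x a * z a * (y b * z b) = x a * y b * (z a * z b) :=
      fun z => by ring
    simp only [this, ← Finset.mul_sum, sum_mul_eq_zero hb.symm, mul_zero]
  · simp

/-- The sum vanishes when some index occurs only once. Otherwise the indices match in pairs; when
all four agree the three pairings all count, whence the correction by -3. -/
theorem sum_mul_four (a b c d : Fin 8) :
    ∑ z ∈ E8Roots, z a * z b * (z c * z d) =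
      (∑ z ∈ E8Roots, z 0 * z 0 * (z 1 * z 1)) *
        ((if a = b then 1 else 0) * (if c = d then 1 else 0) +
          (if a = c then 1 else 0) * (if b = d then 1 else 0) +
          (if a = d then 1 else 0) * (if b = c then 1 else 0)) +
      (∑ z ∈ E8Roots, z 0 * z 0 * (z 0 * z 0) - 3 * ∑ z ∈ E8Roots, z 0 * z 0 * (z 1 * z 1)) *
        ((if a = b then 1 else 0) * (if a = c then 1 else 0) * (if a = d then 1 else 0)) := by
  have h2 : ∑ z ∈ E8Roots, z a * z b * (z c * z d) = ∑ z ∈ E8Roots, z b * z a * (z c * z d) :=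
    Finset.sum_congr rfl fun z _ => by ring
  have h3 : ∑ z ∈ E8Roots, z a * z b * (z c * z d) = ∑ z ∈ E8Roots, z c * z a * (z b * z d) :=
    Finset.sum_congr rfl fun z _ => by ring
  have h4 : ∑ z ∈ E8Roots, z a * z b * (z c * z d) = ∑ z ∈ E8Roots, z d * z a * (z b * z c) :=
    Finset.sum_congr rfl fun z _ => by ring
  by_cases hab : a = b
  · subst hab
    by_cases hcd : c = d
    · subst hcd
      by_cases hac : a = c
      · subst hac
        rw [sum_fourth_eq]
        simp
        ring
      · rw [sum_sq_sq_eq hac]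
        simp [hac]
    · by_cases hac : a = c
      · subst hac
        rw [h4, sum_mul_four_eq_zero hcd hcd hcd]
        simp [hcd]
      · rw [h3, sum_mul_four_eq_zero hac hac (Ne.symm hcd)]
        simp [hac, hcd]
  · by_cases hac : a = c
    · subst hac
      by_cases hbd : b = d
      · subst hbd
        rw [h3]
        rw [sum_sq_sq_eq hab]
        simp [hab]
      · rw [h2, sum_mul_four_eq_zero hab hab (Ne.symm hbd)]
        simp [hab, Ne.symm hab, hbd]
    · by_cases had : a = d
      · subst had
        by_cases hbc : b = c
        · subst hbc
          rw [h4, sum_sq_sq_eq hab]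
          simp [hab]
        · rw [h2, sum_mul_four_eq_zero hab (Ne.symm hbc) hab]
          simp [hab, hbc, hac]
      · rw [sum_mul_four_eq_zero (Ne.symm hab) (Ne.symm hac) (Ne.symm had)]
        simp [hab, hac, had]

theorem sum_inner_sq_mul_inner_sq_aux (x y : EuclideanSpace ℝ (Fin 8)) :
    ∑ z ∈ E8Roots, inner ℝ x z ^ 2 * inner ℝ y z ^ 2 =
      (∑ z ∈ E8Roots, z 0 * z 0 * (z 1 * z 1)) *
        (inner ℝ x x * inner ℝ y y + 2 * inner ℝ x y ^ 2) +
      (∑ z ∈ E8Roots, z 0 * z 0 * (z 0 * z 0) - 3 * ∑ z ∈ E8Roots, z 0 * z 0 * (z 1 * z 1)) *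
        ∑ a, x a ^ 2 * y a ^ 2 := by
  have key : ∀ z : EuclideanSpace ℝ (Fin 8), inner ℝ x z ^ 2 * inner ℝ y z ^ 2 =
      ∑ a, ∑ b, ∑ c, ∑ d, x a * x b * (y c * y d) * (z a * z b * (z c * z d)) := by
    intro z
    rw [inner_eq_sum_mul, inner_eq_sum_mul, sq, sq, Finset.sum_mul_sum, Finset.sum_mul_sum,
      Finset.sum_mul]
    refine Finset.sum_congr rfl fun a _ => ?_
    rw [Finset.sum_mul]
    refine Finset.sum_congr rfl fun b _ => ?_
    rw [Finset.mul_sum]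
    refine Finset.sum_congr rfl fun c _ => ?_
    rw [Finset.mul_sum]
    exact Finset.sum_congr rfl fun d _ => by ring
  have swap : ∑ z ∈ E8Roots, inner ℝ x z ^ 2 * inner ℝ y z ^ 2 = ∑ a, ∑ b, ∑ c, ∑ d,
      x a * x b * (y c * y d) * ∑ z ∈ E8Roots, z a * z b * (z c * z d) := by
    rw [Finset.sum_congr rfl fun z _ => key z, Finset.sum_comm]
    refine Finset.sum_congr rfl fun a _ => ?_
    rw [Finset.sum_comm]
    refine Finset.sum_congr rfl fun b _ => ?_
    rw [Finset.sum_comm]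
    refine Finset.sum_congr rfl fun c _ => ?_
    rw [Finset.sum_comm]
    exact Finset.sum_congr rfl fun d _ => by rw [Finset.mul_sum]
  have e1 : inner ℝ x x * inner ℝ y y = ∑ a, ∑ b, ∑ c, ∑ d, x a * x b * (y c * y d) *
      ((if a = b then 1 else 0) * (if c = d then 1 else 0)) := by
    rw [inner_eq_sum_mul, inner_eq_sum_mul, Finset.sum_mul_sum]
    simp
  have e2 : inner ℝ x y ^ 2 = ∑ a, ∑ b, ∑ c, ∑ d, x a * x b * (y c * y d) *
      ((if a = c then 1 else 0) * (if b = d then 1 else 0)) := by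
    simp [inner_eq_sum_mul, sq, Finset.sum_mul_sum]
    exact Finset.sum_congr rfl fun a _ => Finset.sum_congr rfl fun b _ => by ring
  have e3 : inner ℝ x y ^ 2 = ∑ a, ∑ b, ∑ c, ∑ d, x a * x b * (y c * y d) *
      ((if a = d then 1 else 0) * (if b = c then 1 else 0)) := by
    simp [inner_eq_sum_mul, sq, Finset.sum_mul_sum]
    exact Finset.sum_congr rfl fun a _ => Finset.sum_congr rfl fun b _ => by ring
  have e4 : ∑ a, x a ^ 2 * y a ^ 2 = ∑ a, ∑ b, ∑ c, ∑ d, x a * x b * (y c * y d) *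
      ((if a = b then 1 else 0) * (if a = c then 1 else 0) * (if a = d then 1 else 0)) := by
    simp [sq]
  rw [e4, show inner ℝ x x * inner ℝ y y + 2 * inner ℝ x y ^ 2 =
    inner ℝ x x * inner ℝ y y + inner ℝ x y ^ 2 + inner ℝ x y ^ 2 by ring, e1]
  nth_rw 1 [e2]
  rw [e3]
  rw [swap]
  simp only [Finset.mul_sum (ι := Fin 8), ← Finset.sum_add_distrib]
  refine Finset.sum_congr rfl fun a _ => Finset.sum_congr rfl fun b _ =>
    Finset.sum_congr rfl fun c _ => Finset.sum_congr rfl fun d _ => ?_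
  rw [sum_mul_four]
  ring

/-- Permutations and sign changes leave the non-isotropic term ∑ xₐ² yₐ² possible; the reflection in
r = (1/2, …, 1/2) excludes it. It sends e₀ + e₁ to a vector with all coordinates ±1/2, of the same
length, while the sum of fourth powers of the coordinates drops from 2 to 1/2. So the coefficient
must vanish. -/
theorem sum_fourth_eq_three_mul : ∑ z ∈ E8Roots, z 0 * z 0 * (z 0 * z 0) -
    3 * ∑ z ∈ E8Roots, z 0 * z 0 * (z 1 * z 1) = 0 := by
  set r : EuclideanSpace ℝ (Fin 8) := WithLp.toLp 2 fun _ => 1 / 2 with hr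
  have hrm : r ∈ E8MinimalVectors := by
    refine mem_E8MinimalVectors_iff.2 ⟨⟨Or.inr fun i => ⟨0, by simp [hr]⟩, 2, ?_⟩, ?_⟩
    · simp [hr]
      norm_num
    · rw [inner_eq_sum_mul]
      simp [hr]
      norm_num
  have hw := sum_inner_sq_mul_inner_sq_aux (pairVector 0 1 1 1) (pairVector 0 1 1 1)
  have hw' := sum_inner_sq_mul_inner_sq_aux (rootReflection r (pairVector 0 1 1 1))
    (rootReflection r (pairVector 0 1 1 1))
  have hs := sum_E8Roots_rootReflection hrm fun z =>
    inner ℝ (pairVector 0 1 1 1) z ^ 2 * inner ℝ (pairVector 0 1 1 1) z ^ 2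
  simp only [inner_rootReflection] at hs
  rw [hs, hw] at hw'
  rw [← inner_rootReflection, rootReflection_rootReflection (inner_self_of_mem hrm)] at hw'
  have hc : inner ℝ (pairVector 0 1 1 1) r = 1 := by
    rw [real_inner_comm, inner_pairVector]
    norm_num [hr]
  have happ : ∀ k, rootReflection r (pairVector 0 1 1 1) k = pairVector 0 1 1 1 k - 1 / 2 := by
    intro k
    rw [rootReflection, hc, one_smul]
    rfl
  simp only [happ, Fin.sum_univ_eight, pairVector_apply] at hw'
  norm_num [Fin.ext_iff] at hw'
  linarith

theorem sum_inner_sq_mul_inner_sq (x y : EuclideanSpace ℝ (Fin 8)) :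
    ∑ z ∈ E8Roots, inner ℝ x z ^ 2 * inner ℝ y z ^ 2 =
      (∑ z ∈ E8Roots, z 0 * z 0 * (z 1 * z 1)) *
        (inner ℝ x x * inner ℝ y y + 2 * inner ℝ x y ^ 2) := by
  rw [sum_inner_sq_mul_inner_sq_aux, sum_fourth_eq_three_mul]
  ring

theorem sum_inner_pow_odd (x y : EuclideanSpace ℝ (Fin 8)) {i j : ℕ} (h : Odd (i + j)) :
    ∑ z ∈ E8Roots, inner ℝ x z ^ i * inner ℝ y z ^ j = 0 := by
  have hs := sum_E8Roots_neg fun z => inner ℝ x z ^ i * inner ℝ y z ^ j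
  have : ∀ z, inner ℝ x (-z) ^ i * inner ℝ y (-z) ^ j =
      -(inner ℝ x z ^ i * inner ℝ y z ^ j : ℝ) := by
    intro z
    rw [inner_neg_right, inner_neg_right, neg_pow, neg_pow (inner ℝ y z), mul_mul_mul_comm,
      ← pow_add, h.neg_one_pow, neg_one_mul]
  simp only [this, Finset.sum_neg_distrib] at hs
  linarith

/-! ### The association scheme of minimal vectors -/

/-- A quadratic polynomial whose values at `2` and `-2` are modified. -/
noncomputable def quasiQuadratic (p q r c d a : ℝ) : ℝ :=
  p + q * a + r * a ^ 2 + ((if a = 2 then c else 0) + (if a = -2 then d else 0))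

/-- The quadratic part interpolates at 1, 0, -1; then c and d repair the values at 2 and -2. -/
theorem exists_quasiQuadratic_eq_ite (m : Fin 5) : ∃ p q r c d : ℝ, ∀ i,
    quasiQuadratic p q r c d (E8InnerProduct i) = if i = m then 1 else 0 := by
  have h : ∃ p q r c d : ℝ,
      quasiQuadratic p q r c d 2 = (if 0 = m then 1 else 0) ∧
      quasiQuadratic p q r c d 1 = (if 1 = m then 1 else 0) ∧
      quasiQuadratic p q r c d 0 = (if 2 = m then 1 else 0) ∧
      quasiQuadratic p q r c d (-1) = (if 3 = m then 1 else 0) ∧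
      quasiQuadratic p q r c d (-2) = (if 4 = m then 1 else 0) := by
    fin_cases m
    · exact ⟨0, 0, 0, 1, 0, by norm_num [quasiQuadratic, Fin.ext_iff]⟩
    · exact ⟨0, 1 / 2, 1 / 2, -3, -1, by norm_num [quasiQuadratic, Fin.ext_iff]⟩
    · exact ⟨1, 0, -1, 3, 3, by norm_num [quasiQuadratic, Fin.ext_iff]⟩
    · exact ⟨0, -1 / 2, 1 / 2, -1, -3, by norm_num [quasiQuadratic, Fin.ext_iff]⟩
    · exact ⟨0, 0, 0, 0, 1, by norm_num [quasiQuadratic, Fin.ext_iff]⟩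
  obtain ⟨p, q, r, c, d, h0, h1, h2, h3, h4⟩ := h
  refine ⟨p, q, r, c, d, fun i => ?_⟩
  fin_cases i
  exacts [h0, h1, h2, h3, h4]

theorem sum_ite_inner_eq_two {x : EuclideanSpace ℝ (Fin 8)} (hx : x ∈ E8MinimalVectors) (c : ℝ)
    (f : EuclideanSpace ℝ (Fin 8) → ℝ) :
    ∑ z ∈ E8Roots, (if inner ℝ x z = (2 : ℝ) then c else 0) * f z = c * f x := by
  rw [Finset.sum_eq_single_of_mem x (mem_E8Roots.2 hx), if_pos (inner_self_of_mem hx)]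
  intro z hz hne
  rw [if_neg, zero_mul]
  exact fun h => hne (eq_of_inner_eq_two (inner_self_of_mem hx)
    (inner_self_of_mem (mem_E8Roots.1 hz)) h).symm

theorem sum_ite_inner_eq_neg_two {x : EuclideanSpace ℝ (Fin 8)} (hx : x ∈ E8MinimalVectors) (c : ℝ)
    (f : EuclideanSpace ℝ (Fin 8) → ℝ) :
    ∑ z ∈ E8Roots, (if inner ℝ x z = (-2 : ℝ) then c else 0) * f z = c * f (-x) := by
  rw [← sum_ite_inner_eq_two (neg_mem_E8MinimalVectors hx)]
  simp only [inner_neg_left, neg_eq_iff_eq_neg]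

theorem sum_quasiQuadratic {x y : EuclideanSpace ℝ (Fin 8)} (hx : x ∈ E8MinimalVectors)
    (hy : y ∈ E8MinimalVectors) (p q r c d p' q' r' c' d' : ℝ) :
    ∑ z ∈ E8Roots, quasiQuadratic p q r c d (inner ℝ x z) *
        quasiQuadratic p' q' r' c' d' (inner ℝ y z) =
      (p * p' * E8Roots.card + (p * r' + r * p') * ((∑ z ∈ E8Roots, z 0 * z 0) * 2) +
        q * q' * ((∑ z ∈ E8Roots, z 0 * z 0) * inner ℝ x y) +
        r * r' * ((∑ z ∈ E8Roots, z 0 * z 0 * (z 1 * z 1)) * (2 * 2 + 2 * inner ℝ x y ^ 2))) +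
      (c * quasiQuadratic p' q' r' c' d' (inner ℝ x y) +
        d * quasiQuadratic p' q' r' c' d' (-inner ℝ x y)) +
      (c' * (p + q * inner ℝ x y + r * inner ℝ x y ^ 2) +
        d' * (p + q * (-inner ℝ x y) + r * (-inner ℝ x y) ^ 2)) := by
  -- The corrections of the first factor multiply the whole second factor, those of the second only
  -- the quadratic part of the first, so products of corrections are counted once.
  have e : ∀ z : EuclideanSpace ℝ (Fin 8), quasiQuadratic p q r c d (inner ℝ x z) *
      quasiQuadratic p' q' r' c' d' (inner ℝ y z) =
      (p * p' + (p * r') * (inner ℝ y z * inner ℝ y z) + (r * p') * (inner ℝ x z * inner ℝ x z) +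
        q * q' * (inner ℝ x z * inner ℝ y z) + r * r' * (inner ℝ x z ^ 2 * inner ℝ y z ^ 2) +
        (p * q') * (inner ℝ x z ^ 0 * inner ℝ y z ^ 1) +
        (q * p') * (inner ℝ x z ^ 1 * inner ℝ y z ^ 0) +
        (q * r') * (inner ℝ x z ^ 1 * inner ℝ y z ^ 2) +
        (r * q') * (inner ℝ x z ^ 2 * inner ℝ y z ^ 1)) +
      ((if inner ℝ x z = (2 : ℝ) then c else 0) * quasiQuadratic p' q' r' c' d' (inner ℝ y z) +
        (if inner ℝ x z = (-2 : ℝ) then d else 0) *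
          quasiQuadratic p' q' r' c' d' (inner ℝ y z)) +
      ((if inner ℝ y z = (2 : ℝ) then c' else 0) * (p + q * inner ℝ x z + r * inner ℝ x z ^ 2) +
        (if inner ℝ y z = (-2 : ℝ) then d' else 0) *
          (p + q * inner ℝ x z + r * inner ℝ x z ^ 2)) := by
    intro z
    simp only [quasiQuadratic]
    ring
  simp only [e, Finset.sum_add_distrib, ← Finset.mul_sum]
  rw [sum_ite_inner_eq_two hx c fun z => quasiQuadratic p' q' r' c' d' (inner ℝ y z),
    sum_ite_inner_eq_neg_two hx d fun z => quasiQuadratic p' q' r' c' d' (inner ℝ y z),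
    sum_ite_inner_eq_two hy c' fun z => p + q * inner ℝ x z + r * inner ℝ x z ^ 2,
    sum_ite_inner_eq_neg_two hy d' fun z => p + q * inner ℝ x z + r * inner ℝ x z ^ 2,
    sum_inner_pow_odd x y (by decide : Odd (0 + 1)), sum_inner_pow_odd x y (by decide : Odd (1 + 0)),
    sum_inner_pow_odd x y (by decide : Odd (1 + 2)), sum_inner_pow_odd x y (by decide : Odd (2 + 1)),
    sum_inner_sq_mul_inner_sq, sum_inner_mul_inner, sum_inner_mul_inner, sum_inner_mul_inner,
    inner_self_of_mem hx, inner_self_of_mem hy, inner_neg_right, inner_neg_right,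
    real_inner_comm x y, Finset.sum_const, nsmul_eq_mul]
  ring

/-- The class of a pair of minimal vectors. -/
noncomputable def E8Class (x y : E8MinimalVectors) : Fin 5 :=
  (exists_E8InnerProduct x.2 y.2).choose

theorem E8InnerProduct_E8Class (x y : E8MinimalVectors) :
    E8InnerProduct (E8Class x y) =
      inner ℝ (x : EuclideanSpace ℝ (Fin 8)) (y : EuclideanSpace ℝ (Fin 8)) :=
  (exists_E8InnerProduct x.2 y.2).choose_spec.symm

theorem E8Class_eq_iff {x y : E8MinimalVectors} {i : Fin 5} : E8Class x y = i ↔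
    inner ℝ (x : EuclideanSpace ℝ (Fin 8)) (y : EuclideanSpace ℝ (Fin 8)) = E8InnerProduct i := by
  rw [← E8InnerProduct_E8Class, E8InnerProduct_injective.eq_iff]

theorem sum_E8MinimalVectors [Fintype E8MinimalVectors] (f : EuclideanSpace ℝ (Fin 8) → ℝ) :
    ∑ z : E8MinimalVectors, f z = ∑ z ∈ E8Roots, f z :=
  (Finset.sum_subtype E8Roots (fun _ => mem_E8Roots) f).symm

theorem ncard_setOf_eq_sum {X : Type*} [Fintype X] (p q : X → Prop) [DecidablePred p]
    [DecidablePred q] : ({z | p z ∧ q z}.ncard : ℝ) =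
      ∑ z, (if p z then 1 else 0) * (if q z then 1 else 0) := by
  rw [Set.ncard_eq_toFinset_card']
  simp [← ite_and, Finset.sum_boole, and_comm]

theorem ncard_E8Class_congr {x y x' y' : E8MinimalVectors} (h : E8Class x y = E8Class x' y')
    (m n : Fin 5) : {z | E8Class x z = m ∧ E8Class y z = n}.ncard =
      {z | E8Class x' z = m ∧ E8Class y' z = n}.ncard := by
  have : Fintype E8MinimalVectors := finite_E8MinimalVectors.fintype
  obtain ⟨p, q, r, c, d, hm⟩ := exists_quasiQuadratic_eq_ite m
  obtain ⟨p', q', r', c', d', hn⟩ := exists_quasiQuadratic_eq_ite n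
  have key : ∀ x y : E8MinimalVectors, ({z | E8Class x z = m ∧ E8Class y z = n}.ncard : ℝ) =
      ∑ z ∈ E8Roots, quasiQuadratic p q r c d (inner ℝ (x : EuclideanSpace ℝ (Fin 8)) z) *
        quasiQuadratic p' q' r' c' d' (inner ℝ (y : EuclideanSpace ℝ (Fin 8)) z) := by
    intro x y
    rw [ncard_setOf_eq_sum, ← sum_E8MinimalVectors]
    refine Finset.sum_congr rfl fun z _ => ?_
    rw [← E8InnerProduct_E8Class, ← E8InnerProduct_E8Class, hm, hn]
  have hxy := congrArg E8InnerProduct h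
  rw [E8InnerProduct_E8Class, E8InnerProduct_E8Class] at hxy
  have := (sum_quasiQuadratic x.2 y.2 p q r c d p' q' r' c' d')
  rw [hxy, ← sum_quasiQuadratic x'.2 y'.2 p q r c d p' q' r' c' d', ← key, ← key] at this
  exact_mod_cast this

theorem exists_E8Class_eq (i : Fin 5) : ∃ xy : E8MinimalVectors × E8MinimalVectors,
    E8Class xy.1 xy.2 = i := by
  have h : ∀ s : ℤ, s ^ 2 = 1 → ∀ j k : Fin 8, j ≠ k → ∃ xy : E8MinimalVectors × E8MinimalVectors,
      inner ℝ (xy.1 : EuclideanSpace ℝ (Fin 8)) (xy.2 : EuclideanSpace ℝ (Fin 8)) =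
        inner ℝ (pairVector 0 1 ((1 : ℤ) : ℝ) ((1 : ℤ) : ℝ)) (pairVector j k s s) :=
    fun s hs j k hjk => ⟨⟨⟨_, pairVector_mem (by decide) (one_pow 2) (one_pow 2)⟩,
      ⟨_, pairVector_mem hjk hs hs⟩⟩, rfl⟩
  simp only [E8Class_eq_iff]
  fin_cases i
  · convert h 1 (by norm_num) 0 1 (by decide)
    rw [inner_pairVector]
    norm_num [E8InnerProduct, pairVector_apply, Fin.ext_iff]
  · convert h 1 (by norm_num) 0 2 (by decide)
    rw [inner_pairVector]
    norm_num [E8InnerProduct, pairVector_apply, Fin.ext_iff]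
  · convert h 1 (by norm_num) 2 3 (by decide)
    rw [inner_pairVector]
    norm_num [E8InnerProduct, pairVector_apply, Fin.ext_iff]
  · convert h (-1) (by norm_num) 0 2 (by decide)
    rw [inner_pairVector]
    norm_num [E8InnerProduct, pairVector_apply, Fin.ext_iff]
  · convert h (-1) (by norm_num) 0 1 (by decide)
    rw [inner_pairVector]
    norm_num [E8InnerProduct, pairVector_apply, Fin.ext_iff]

/-- The association scheme of the minimal vectors of the `E₈` lattice. -/
noncomputable def E8Scheme : AssociationScheme 4 E8MinimalVectors where
  finite := finite_E8MinimalVectors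
  cls := E8Class
  cls_nonempty i := let ⟨xy, h⟩ := exists_E8Class_eq i; ⟨xy.1, xy.2, h⟩
  cls_eq_zero_iff x y := by
    rw [E8Class_eq_iff]
    constructor
    · intro h
      exact Subtype.ext (eq_of_inner_eq_two (inner_self_of_mem x.2) (inner_self_of_mem y.2) h)
    · rintro rfl
      exact inner_self_of_mem x.2
  cls_symm x y := by rw [E8Class_eq_iff, E8InnerProduct_E8Class, real_inner_comm]
  inter l m n := {z | E8Class (exists_E8Class_eq l).choose.1 z = m ∧
    E8Class (exists_E8Class_eq l).choose.2 z = n}.ncard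
  ncard_eq_inter l m n x y h :=
    ncard_E8Class_congr (h.trans (exists_E8Class_eq l).choose_spec.symm) m n

/-! ### Parameters of an association scheme -/

theorem AssociationScheme.sum_cls_cls {k : ℕ} {X : Type*} [Fintype X] (A : AssociationScheme k X)
    (f : Fin (k + 1) → Fin (k + 1) → ℝ) (x y : X) :
    ∑ z, f (A.cls x z) (A.cls y z) = ∑ m, ∑ n, f m n * A.inter (A.cls x y) m n := by
  simp only [← A.ncard_eq_inter _ _ _ x y rfl, ncard_setOf_eq_sum, Finset.mul_sum]
  rw [Finset.sum_congr rfl fun m _ => Finset.sum_comm, Finset.sum_comm]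
  refine Finset.sum_congr rfl fun z _ => ?_
  simp

/-- Carries identities from the minimal vectors over to any scheme with the same parameters. -/
theorem AssociationScheme.SameParameters.sum_cls_cls_eq {k : ℕ} {X Y : Type*} [Fintype X]
    [Fintype Y] {A : AssociationScheme k X} {B : AssociationScheme k Y} (h : A.SameParameters B)
    (f : Fin (k + 1) → Fin (k + 1) → ℝ) {x y : X} {x' y' : Y} (hxy : A.cls x y = B.cls x' y') :
    ∑ z, f (A.cls x z) (A.cls y z) = ∑ z, f (B.cls x' z) (B.cls y' z) := by
  rw [A.sum_cls_cls, B.sum_cls_cls, hxy]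
  simp only [h.inter_eq]

/-- Both sides compute ∑ ⟨z,z⟩. This is the trace condition that later fixes the dimension as eight,
without the cardinality being computed. -/
theorem two_mul_card_E8Roots : 2 * (E8Roots.card : ℝ) = 8 * ∑ z ∈ E8Roots, z 0 * z 0 := by
  have h1 : ∑ z ∈ E8Roots, inner ℝ z z = 2 * (E8Roots.card : ℝ) := by
    rw [Finset.sum_congr rfl fun z hz => inner_self_of_mem (mem_E8Roots.1 hz), Finset.sum_const,
      nsmul_eq_mul, mul_comm]
  rw [← h1]
  simp only [inner_eq_sum_mul]
  rw [Finset.sum_comm]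
  simp only [sum_mul_self_eq, Finset.sum_const, Finset.card_univ, Fintype.card_fin, nsmul_eq_mul]
  norm_num

theorem card_E8Roots_pos : 0 < E8Roots.card :=
  Finset.card_pos.2 ⟨_, mem_E8Roots.2
    (pairVector_mem (show (0 : Fin 8) ≠ 1 by decide) (one_pow 2) (one_pow 2))⟩

section Parameters

variable {X : Type*} [Fintype X] {A : AssociationScheme 4 X}

/-- The matrix identity G² = cG, with G symmetric. -/
theorem sum_E8InnerProduct_mul (h : A.SameParameters E8Scheme) (x y : X) :
    ∑ z, E8InnerProduct (A.cls x z) * E8InnerProduct (A.cls y z) =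
      (∑ z ∈ E8Roots, z 0 * z 0) * E8InnerProduct (A.cls x y) := by
  have : Fintype E8MinimalVectors := finite_E8MinimalVectors.fintype
  obtain ⟨x', y', hxy⟩ := E8Scheme.cls_nonempty (A.cls x y)
  rw [h.sum_cls_cls_eq (fun m n => E8InnerProduct m * E8InnerProduct n) hxy.symm, ← hxy]
  change ∑ z, E8InnerProduct (E8Class x' z) * E8InnerProduct (E8Class y' z) =
    _ * E8InnerProduct (E8Class x' y')
  simp only [E8InnerProduct_E8Class]
  rw [sum_E8MinimalVectors fun z => inner ℝ (x' : EuclideanSpace ℝ (Fin 8)) z *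
    inner ℝ (y' : EuclideanSpace ℝ (Fin 8)) z, sum_inner_mul_inner]

theorem card_eq_card_E8Roots (h : A.SameParameters E8Scheme) : Fintype.card X = E8Roots.card := by
  rw [← Nat.card_eq_fintype_card, h.size_eq, Nat.card_coe_set_eq,
    Set.ncard_eq_toFinset_card _ finite_E8MinimalVectors]
  rfl

/-- Since u + v = 2e₀, every e₀ ± eᵢ with i ≠ 0 is counted. -/
theorem fourteen_le_card_E8 [Fintype E8MinimalVectors] {u v : E8MinimalVectors}
    (hu : (u : EuclideanSpace ℝ (Fin 8)) = pairVector 0 1 1 1)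
    (hv : (v : EuclideanSpace ℝ (Fin 8)) = pairVector 0 1 1 (-1)) :
    14 ≤ (Finset.univ.filter fun z : E8MinimalVectors =>
      E8InnerProduct (E8Class u z) + E8InnerProduct (E8Class v z) = 2).card := by
  have hs : ∀ b : Bool, (if b then 1 else -1 : ℤ) ^ 2 = 1 := by decide
  let f : Fin 7 × Bool → E8MinimalVectors := fun q =>
    ⟨_, pairVector_mem (Fin.succ_ne_zero q.1).symm (one_pow 2) (hs q.2)⟩
  have hf : Function.Injective f := by
    rintro ⟨i, a⟩ ⟨j, b⟩ h
    have h' := congrArg (fun z : E8MinimalVectors => (z : EuclideanSpace ℝ (Fin 8)) i.succ) h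
    simp only [f, pairVector_apply, Fin.succ_ne_zero, if_false, if_true, Fin.succ_inj] at h'
    by_cases hij : i = j
    · subst hij
      cases a <;> cases b <;> first | rfl | norm_num at h'
    · cases a <;> norm_num [hij] at h'
  calc 14 = (Finset.univ.map ⟨f, hf⟩).card := by simp
    _ ≤ _ := Finset.card_le_card fun z hz => ?_
  obtain ⟨q, -, rfl⟩ := Finset.mem_map.1 hz
  rw [Finset.mem_filter]
  refine ⟨Finset.mem_univ _, ?_⟩
  rw [E8InnerProduct_E8Class, E8InnerProduct_E8Class, ← inner_add_left, real_inner_comm, hu, hv,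
    inner_add_right, inner_pairVector, inner_pairVector]
  simp only [f, Function.Embedding.coeFn_mk, pairVector_apply, (Fin.succ_ne_zero q.1).symm]
  norm_num
  ring

theorem exists_orthogonal_pair (h : A.SameParameters E8Scheme) : ∃ u v : X,
    E8InnerProduct (A.cls u v) = 0 ∧ 14 ≤ (Finset.univ.filter fun z : X =>
      E8InnerProduct (A.cls u z) + E8InnerProduct (A.cls v z) = 2).card := by
  classical
  have : Fintype E8MinimalVectors := finite_E8MinimalVectors.fintype
  obtain ⟨u, v, huv⟩ := A.cls_nonempty 2
  refine ⟨u, v, by rw [huv]; simp [E8InnerProduct], ?_⟩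
  have h01 : (0 : Fin 8) ≠ 1 := by decide
  have hu := pairVector_mem h01 (s := 1) (t := 1) (by norm_num) (by norm_num)
  have hv := pairVector_mem h01 (s := 1) (t := -1) (by norm_num) (by norm_num)
  have hcls : A.cls u v = E8Scheme.cls ⟨_, hu⟩ ⟨_, hv⟩ := by
    rw [huv]
    symm
    refine E8Class_eq_iff.2 ?_
    rw [inner_pairVector]
    norm_num [pairVector_apply]
    rfl
  have key := h.sum_cls_cls_eq
    (fun m n => if E8InnerProduct m + E8InnerProduct n = 2 then 1 else 0) hcls
  simp only [Finset.sum_boole] at key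
  rw [Nat.cast_inj] at key
  rw [key]
  exact fourteen_le_card_E8 (by push_cast; rfl) (by push_cast; rfl)

end Parameters

/-! ### Realization in Euclidean space -/

/-- The rows of G/√c have Gram matrix GGᵀ/c, which is G by hypothesis. -/
theorem exists_inner_eq {X : Type*} [Fintype X] {G : X → X → ℝ} {c : ℝ} (hc : 0 < c)
    (hG : ∀ x y, ∑ z, G x z * G y z = c * G x y) :
    ∃ v : X → EuclideanSpace ℝ X, ∀ x y, inner ℝ (v x) (v y) = G x y := by
  refine ⟨fun x => WithLp.toLp 2 fun z => G x z / √c, fun x y => ?_⟩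
  rw [inner_eq_sum_mul]
  simp only [div_mul_div_comm, Real.mul_self_sqrt hc.le, ← Finset.sum_div, hG]
  field_simp

section Frame

variable {X V : Type*} [Fintype X] [NormedAddCommGroup V] [InnerProductSpace ℝ V]

theorem sum_inner_mul_inner_of_mem_span {v : X → V} {c : ℝ}
    (hv : ∀ x y, ∑ z, inner ℝ (v x) (v z) * inner ℝ (v y) (v z) = c * inner ℝ (v x) (v y))
    {a b : V} (ha : a ∈ Submodule.span ℝ (Set.range v)) (hb : b ∈ Submodule.span ℝ (Set.range v)) :
    ∑ z, inner ℝ a (v z) * inner ℝ b (v z) = c * inner ℝ a b := by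
  induction ha using Submodule.span_induction with
  | mem a ha =>
    obtain ⟨x, rfl⟩ := ha
    induction hb using Submodule.span_induction with
    | mem b hb =>
      obtain ⟨y, rfl⟩ := hb
      exact hv x y
    | zero => simp
    | add b b' _ _ h h' =>
      simp only [inner_add_left, inner_add_right, mul_add, Finset.sum_add_distrib, h, h']
    | smul r b _ h =>
      simp only [inner_smul_left, inner_smul_right, conj_trivial, mul_left_comm _ r,
        ← Finset.mul_sum, h]
  | zero => simp
  | add a a' _ _ h h' =>
    simp only [inner_add_left, mul_add, add_mul, Finset.sum_add_distrib, h, h']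
  | smul r a _ h =>
    simp only [inner_smul_left, conj_trivial, mul_assoc, mul_left_comm _ r, ← Finset.mul_sum, h]

/-- The squared distances of the v x from the span of e add up to nc - ∑ᵢ c⟨eᵢ,eᵢ⟩ = 0, so each of
them vanishes and e expands every v x. -/
theorem inner_eq_sum_of_tight_frame {n : ℕ} {v : X → V} {c : ℝ}
    (hv : ∀ x y, ∑ z, inner ℝ (v x) (v z) * inner ℝ (v y) (v z) = c * inner ℝ (v x) (v y))
    (htr : ∑ x, inner ℝ (v x) (v x) = n * c) {e : Fin n → V} (he : Orthonormal ℝ e)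
    (hs : ∀ i, e i ∈ Submodule.span ℝ (Set.range v)) (x y : X) :
    inner ℝ (v x) (v y) = ∑ i, inner ℝ (e i) (v x) * inner ℝ (e i) (v y) := by
  have hnorm : ∀ w : V, inner ℝ (w - ∑ i, inner ℝ (e i) w • e i)
      (w - ∑ i, inner ℝ (e i) w • e i) = inner ℝ w w - ∑ i, inner ℝ (e i) w * inner ℝ (e i) w := by
    intro w
    have h1 : inner ℝ (∑ i, inner ℝ (e i) w • e i) w = ∑ i, inner ℝ (e i) w * inner ℝ (e i) w := by
      simp [sum_inner, inner_smul_left]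
    have h2 : inner ℝ (∑ i, inner ℝ (e i) w • e i) (∑ i, inner ℝ (e i) w • e i) =
        ∑ i, inner ℝ (e i) w * inner ℝ (e i) w := by
      rw [he.inner_sum]
      simp
    rw [inner_sub_sub_self, real_inner_comm (∑ i, inner ℝ (e i) w • e i) w, h1, h2]
    ring
  have hzero : ∑ x, inner ℝ (v x - ∑ i, inner ℝ (e i) (v x) • e i)
      (v x - ∑ i, inner ℝ (e i) (v x) • e i) = 0 := by
    simp only [hnorm, Finset.sum_sub_distrib, htr]
    rw [Finset.sum_comm]
    simp only [sum_inner_mul_inner_of_mem_span hv (hs _) (hs _), real_inner_self_eq_norm_sq,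
      he.norm_eq_one]
    simp
  have hx := (Finset.sum_eq_zero_iff_of_nonneg fun x _ => real_inner_self_nonneg).1 hzero x
    (Finset.mem_univ x)
  rw [inner_self_eq_zero, sub_eq_zero] at hx
  conv_lhs => rw [hx]
  simp [sum_inner, inner_smul_left]

end Frame

/-- Pick a and discard ±a. Unit vectors with inner product ±1 agree up to sign, so everything left
is orthogonal to a, and each choice costs at most two vectors. -/
theorem exists_orthonormal_of_two_mul_le_card {V : Type*} [NormedAddCommGroup V]
    [InnerProductSpace ℝ V] (k : ℕ) (S : Finset V) (h1 : ∀ a ∈ S, ‖a‖ = 1)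
    (h2 : ∀ a ∈ S, ∀ b ∈ S, inner ℝ a b = (1 : ℝ) ∨ inner ℝ a b = (0 : ℝ) ∨ inner ℝ a b = (-1 : ℝ))
    (hk : 2 * k ≤ S.card) : ∃ e : Fin k → V, Orthonormal ℝ e ∧ ∀ i, e i ∈ S := by
  classical
  induction k generalizing S with
  | zero => exact ⟨Fin.elim0, ⟨fun i => i.elim0, fun i => i.elim0⟩, fun i => i.elim0⟩
  | succ k ih =>
    obtain ⟨a, ha⟩ : S.Nonempty := Finset.card_pos.1 (by omega)
    have hsub : (S \ {a, -a}) ⊆ S := Finset.sdiff_subset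
    obtain ⟨e, he, heS⟩ := ih (S \ {a, -a}) (fun b hb => h1 b (hsub hb))
      (fun b hb b' hb' => h2 b (hsub hb) b' (hsub hb')) (by
        have := Finset.le_card_sdiff {a, -a} S
        have := Finset.card_le_two (a := a) (b := -a)
        omega)
    have horth : ∀ i, inner ℝ a (e i) = (0 : ℝ) := by
      intro i
      have hi := Finset.mem_sdiff.1 (heS i)
      simp only [Finset.mem_insert, Finset.mem_singleton, not_or] at hi
      rcases h2 a ha _ hi.1 with h | h | h
      · exact absurd ((inner_eq_one_iff_of_norm_eq_one (h1 a ha) (h1 _ hi.1)).1 h).symm hi.2.1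
      · exact h
      · refine absurd ?_ hi.2.2
        have h' : inner ℝ (-a) (e i) = (1 : ℝ) := by rw [inner_neg_left, h, neg_neg]
        exact ((inner_eq_one_iff_of_norm_eq_one (by rw [norm_neg, h1 a ha]) (h1 _ hi.1)).1 h').symm
    refine ⟨Matrix.vecCons a e, orthonormal_vecCons_iff.2 ⟨h1 a ha, horth, he⟩, ?_⟩
    exact Fin.cases ha fun i => hsub (heS i)

/-! ### Recognition of the lattice -/

/-- Multiplication of the last coordinate by `s`. -/
def scaleLast (s : ℝ) (x : EuclideanSpace ℝ (Fin 8)) : EuclideanSpace ℝ (Fin 8) :=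
  WithLp.toLp 2 fun i => if i = 7 then s * x i else x i

theorem scaleLast_apply (s : ℝ) (x : EuclideanSpace ℝ (Fin 8)) (i : Fin 8) :
    scaleLast s x i = if i = 7 then s * x i else x i := rfl

theorem scaleLast_one (x : EuclideanSpace ℝ (Fin 8)) : scaleLast 1 x = x := by
  ext i
  simp [scaleLast_apply]

theorem inner_scaleLast {s : ℝ} (hs : s * s = 1) (x y : EuclideanSpace ℝ (Fin 8)) :
    inner ℝ (scaleLast s x) (scaleLast s y) = inner ℝ x y := by
  rw [inner_eq_sum_mul, inner_eq_sum_mul]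
  refine Finset.sum_congr rfl fun i _ => ?_
  rw [scaleLast_apply, scaleLast_apply]
  split_ifs
  · linear_combination x i * y i * hs
  · rfl

theorem sum_scaleLast_neg_one (x : EuclideanSpace ℝ (Fin 8)) :
    ∑ i, scaleLast (-1) x i = ∑ i, x i - 2 * x 7 := by
  simp only [scaleLast_apply, Fin.sum_univ_eight]
  norm_num [Fin.ext_iff]
  ring

/-- As p² ≡ p mod 2, the coordinate sum has the parity of the squared length 2. -/
theorem mem_E8MinimalVectors_of_int {x : EuclideanSpace ℝ (Fin 8)} (h : ∀ i, ∃ n : ℤ, x i = n)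
    (h2 : inner ℝ x x = 2) : x ∈ E8MinimalVectors := by
  refine mem_E8MinimalVectors_iff.2 ⟨⟨Or.inl h, ?_⟩, h2⟩
  choose p hp using h
  rw [inner_eq_sum_mul] at h2
  simp only [hp, ← sq] at h2 ⊢
  obtain ⟨k, hk⟩ := even_sum_sq_sub_sum Finset.univ p
  have hk' := congrArg (Int.cast : ℤ → ℝ) hk
  refine ⟨1 - k, ?_⟩
  push_cast at hk' ⊢
  linarith

theorem exists_sum_eq_int {x : EuclideanSpace ℝ (Fin 8)} (h : ∀ i, ∃ n : ℤ, x i = n + 1 / 2) :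
    ∃ m : ℤ, ∑ i, x i = m := by
  choose p hp using h
  refine ⟨∑ i, p i + 4, ?_⟩
  simp only [hp, Finset.sum_add_distrib, Finset.sum_const, Finset.card_univ, Fintype.card_fin,
    nsmul_eq_mul]
  push_cast
  ring

/-- With x = p + 1/2 and y = q + 1/2, the inner product is ∑ pq + (∑ p + ∑ q)/2 + 2, and the
coordinate sums are ∑ p + 4 and ∑ q + 4. Thus the half-odd vectors of an integral system share one
parity of coordinate sum. -/
theorem exists_sum_add_sum_eq_two_mul {x y : EuclideanSpace ℝ (Fin 8)}
    (hx : ∀ i, ∃ n : ℤ, x i = n + 1 / 2) (hy : ∀ i, ∃ n : ℤ, y i = n + 1 / 2)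
    (hxy : ∃ n : ℤ, inner ℝ x y = n) : ∃ m : ℤ, ∑ i, x i + ∑ i, y i = 2 * m := by
  choose p hp using hx
  choose q hq using hy
  obtain ⟨n, hn⟩ := hxy
  refine ⟨n - ∑ i, p i * q i + 2, ?_⟩
  rw [inner_eq_sum_mul] at hn
  have h : ∀ i, ((p i : ℝ) + 1 / 2) * (q i + 1 / 2) =
      p i * q i + p i * (1 / 2) + q i * (1 / 2) + 1 / 4 := fun i => by ring
  simp only [hp, hq, h, Finset.sum_add_distrib, ← Finset.sum_mul, Finset.sum_const,
    Finset.card_univ, Fintype.card_fin, nsmul_eq_mul] at hn ⊢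
  push_cast at *
  linarith

theorem int_or_half_int {x : EuclideanSpace ℝ (Fin 8)} (h0 : ∃ n : ℤ, 2 * x 0 = n)
    (h : ∀ i : Fin 7, ∃ n : ℤ, x 0 + x i.succ = n) :
    (∀ i, ∃ n : ℤ, x i = n) ∨ ∀ i, ∃ n : ℤ, x i = n + 1 / 2 := by
  obtain ⟨n, hn⟩ := h0
  rcases Int.even_or_odd' n with ⟨k, rfl | rfl⟩
  · left
    refine Fin.cases ⟨k, by push_cast at hn; linarith⟩ fun i => ?_
    obtain ⟨m, hm⟩ := h i
    exact ⟨m - k, by push_cast at *; linarith⟩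
  · right
    refine Fin.cases ⟨k, by push_cast at hn; linarith⟩ fun i => ?_
    obtain ⟨m, hm⟩ := h i
    exact ⟨m - k - 1, by push_cast at *; linarith⟩

/-- Integral vectors qualify for either sign. If the common parity of the half-odd vectors is odd,
negating the last coordinate changes each of their sums by the odd integer 2x₇. -/
theorem exists_scaleLast_mem {X : Type*} {p : X → EuclideanSpace ℝ (Fin 8)}
    (hint : ∀ x y, ∃ n : ℤ, inner ℝ (p x) (p y) = n) (hself : ∀ x, inner ℝ (p x) (p x) = (2 : ℝ))
    (h0 : ∀ x, ∃ n : ℤ, 2 * p x 0 = n) (h : ∀ x (i : Fin 7), ∃ n : ℤ, p x 0 + p x i.succ = n) :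
    ∃ s : ℝ, s * s = 1 ∧ ∀ x, scaleLast s (p x) ∈ E8MinimalVectors := by
  by_cases hodd : ∃ y, (∀ i, ∃ n : ℤ, p y i = n + 1 / 2) ∧ ∃ m : ℤ, ∑ i, p y i = 2 * m + 1
  · obtain ⟨y, hy, m, hm⟩ := hodd
    have hs : (-1 : ℝ) * -1 = 1 := by norm_num
    refine ⟨-1, hs, fun x => ?_⟩
    have h2 : inner ℝ (scaleLast (-1) (p x)) (scaleLast (-1) (p x)) = 2 := by
      rw [inner_scaleLast hs, hself]
    rcases int_or_half_int (h0 x) (h x) with hx | hx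
    · refine mem_E8MinimalVectors_of_int (fun i => ?_) h2
      obtain ⟨n, hn⟩ := hx i
      rw [scaleLast_apply, hn]
      split_ifs
      · exact ⟨-n, by push_cast; ring⟩
      · exact ⟨n, rfl⟩
    · refine mem_E8MinimalVectors_iff.2 ⟨⟨Or.inr fun i => ?_, ?_⟩, h2⟩
      · obtain ⟨n, hn⟩ := hx i
        rw [scaleLast_apply, hn]
        split_ifs
        · exact ⟨-n - 1, by push_cast; ring⟩
        · exact ⟨n, rfl⟩
      · obtain ⟨k, hk⟩ := exists_sum_add_sum_eq_two_mul hx hy (hint x y)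
        obtain ⟨n, hn⟩ := hx 7
        refine ⟨k - m - 1 - n, ?_⟩
        rw [sum_scaleLast_neg_one, hn]
        push_cast
        linarith
  · refine ⟨1, one_mul 1, fun x => ?_⟩
    rw [scaleLast_one]
    rcases int_or_half_int (h0 x) (h x) with hx | hx
    · exact mem_E8MinimalVectors_of_int hx (hself x)
    · refine mem_E8MinimalVectors_iff.2 ⟨⟨Or.inr hx, ?_⟩, hself x⟩
      obtain ⟨m, hm⟩ := exists_sum_eq_int hx
      rcases Int.even_or_odd' m with ⟨k, rfl | rfl⟩
      · exact ⟨k, by rw [hm]; push_cast; ring⟩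
      · exact absurd ⟨x, hx, k, by rw [hm]; push_cast; ring⟩ hodd

/-! ### Uniqueness -/

theorem E8InnerProduct_int (i : Fin 5) : ∃ n : ℤ, E8InnerProduct i = n := by
  fin_cases i
  exacts [⟨2, by simp [E8InnerProduct]⟩, ⟨1, by simp [E8InnerProduct]⟩,
    ⟨0, by simp [E8InnerProduct]⟩, ⟨-1, by simp [E8InnerProduct]⟩, ⟨-2, by simp [E8InnerProduct]⟩]

/-- Two orthogonal vectors `u`, `w` of norm `√2` and fourteen vectors having inner product `2` with
`u + w` produce an orthonormal family in which the system has (half-)integral coordinates. -/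
theorem exists_orthonormal_frame {X V : Type*} [NormedAddCommGroup V]
    [InnerProductSpace ℝ V] {v : X → V} (hself : ∀ x, inner ℝ (v x) (v x) = (2 : ℝ))
    (hint : ∀ x y, ∃ n : ℤ, inner ℝ (v x) (v y) = n) (hinj : Function.Injective v)
    {u w : X} (huw : inner ℝ (v u) (v w) = (0 : ℝ)) {T : Finset X} (hT : 14 ≤ T.card)
    (hT2 : ∀ z ∈ T, inner ℝ (v u) (v z) + inner ℝ (v w) (v z) = (2 : ℝ)) :
    ∃ e : Fin 8 → V, Orthonormal ℝ e ∧ (∀ i, e i ∈ Submodule.span ℝ (Set.range v)) ∧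
      (∀ x, ∃ n : ℤ, 2 * inner ℝ (e 0) (v x) = (n : ℝ)) ∧
      ∀ x (i : Fin 7), ∃ n : ℤ, inner ℝ (e 0) (v x) + inner ℝ (e i.succ) (v x) = (n : ℝ) := by
  classical
  -- In the model u = e₀ + e₁, w = e₀ - e₁, this is e₀, and the vectors z - a below are the ±eᵢ.
  set a : V := (1 / 2 : ℝ) • (v u + v w) with ha
  have hav : ∀ y : V, inner ℝ a y = 1 / 2 * (inner ℝ (v u) y + inner ℝ (v w) y) := by
    intro y
    rw [ha, inner_smul_left, inner_add_left]
    simp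
  have haa : inner ℝ a a = (1 : ℝ) := by
    rw [hav, real_inner_comm a (v u), real_inner_comm a (v w), hav, hav, hself, hself, huw,
      real_inner_comm (v u) (v w), huw]
    norm_num
  have haT : ∀ z ∈ T, inner ℝ a (v z) = (1 : ℝ) := by
    intro z hz
    rw [hav, hT2 z hz]
    norm_num
  have hab : ∀ z ∈ T, ∀ z' ∈ T, inner ℝ (v z - a) (v z' - a) = inner ℝ (v z) (v z') - (1 : ℝ) := by
    intro z hz z' hz'
    rw [inner_sub_left, inner_sub_right, inner_sub_right, real_inner_comm a (v z), haT z hz,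
      haT z' hz', haa]
    ring
  have hmem : ∀ b ∈ T.image fun z => v z - a, ∃ z ∈ T, v z - a = b := fun b hb =>
    Finset.mem_image.1 hb
  have hnorm : ∀ b ∈ T.image fun z => v z - a, ‖b‖ = 1 := by
    intro b hb
    obtain ⟨z, hz, rfl⟩ := hmem b hb
    rw [norm_eq_sqrt_real_inner, hab z hz z hz, hself]
    norm_num
  obtain ⟨e, he, heT⟩ := exists_orthonormal_of_two_mul_le_card 7 (T.image fun z => v z - a) hnorm
    (fun b hb b' hb' => by
      have hle := abs_real_inner_le_norm b b'
      rw [hnorm b hb, hnorm b' hb', one_mul] at hle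
      obtain ⟨z, hz, rfl⟩ := hmem b hb
      obtain ⟨z', hz', rfl⟩ := hmem b' hb'
      obtain ⟨n, hn⟩ := hint z z'
      rw [hab z hz z' hz', hn] at hle ⊢
      obtain ⟨h1, h2⟩ := abs_le.1 hle
      have h1' : -1 ≤ n - 1 := by exact_mod_cast h1
      have h2' : n - 1 ≤ 1 := by exact_mod_cast h2
      have h3 : 0 ≤ n := by omega
      have h4 : n ≤ 2 := by omega
      interval_cases n <;> norm_num)
    (by rwa [Finset.card_image_of_injective _ fun z z' h => hinj (sub_left_injective h)])
  have ha_span : a ∈ Submodule.span ℝ (Set.range v) :=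
    Submodule.smul_mem _ _ (add_mem (Submodule.subset_span ⟨u, rfl⟩)
      (Submodule.subset_span ⟨w, rfl⟩))
  refine ⟨Matrix.vecCons a e, orthonormal_vecCons_iff.2 ⟨?_, ?_, he⟩, ?_, ?_, ?_⟩
  · rw [norm_eq_sqrt_real_inner, haa, Real.sqrt_one]
  · intro i
    obtain ⟨z, hz, hi⟩ := hmem _ (heT i)
    rw [← hi, inner_sub_right, haT z hz, haa, sub_self]
  · refine Fin.cases ha_span fun i => ?_
    obtain ⟨z, hz, hi⟩ := hmem _ (heT i)
    rw [Matrix.cons_val_succ, ← hi]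
    exact sub_mem (Submodule.subset_span ⟨z, rfl⟩) ha_span
  · intro x
    obtain ⟨m, hm⟩ := hint u x
    obtain ⟨n, hn⟩ := hint w x
    refine ⟨m + n, ?_⟩
    rw [Matrix.cons_val_zero, hav, hm, hn]
    push_cast
    ring
  -- The basis vector is z - a, so adding a gives z itself, whose inner products are integers.
  · intro x i
    obtain ⟨z, hz, hi⟩ := hmem _ (heT i)
    obtain ⟨n, hn⟩ := hint z x
    refine ⟨n, ?_⟩
    rw [Matrix.cons_val_zero, Matrix.cons_val_succ, ← hi, inner_sub_left, hn]
    ring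

theorem isIsomorphic_E8Scheme {X : Type*} {A : AssociationScheme 4 X}
    (h : A.SameParameters E8Scheme) : A.IsIsomorphic E8Scheme := by
  have := A.finite
  have := Fintype.ofFinite X
  have : Finite E8MinimalVectors := finite_E8MinimalVectors
  have htr := two_mul_card_E8Roots
  have hpos : 0 < ∑ z ∈ E8Roots, z 0 * z 0 := by
    have : (0 : ℝ) < E8Roots.card := by exact_mod_cast card_E8Roots_pos
    linarith
  obtain ⟨v, hv⟩ := exists_inner_eq hpos (sum_E8InnerProduct_mul h)
  have hself : ∀ x, inner ℝ (v x) (v x) = (2 : ℝ) := by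
    intro x
    rw [hv, (A.cls_eq_zero_iff x x).2 rfl]
    rfl
  have hint : ∀ x y, ∃ n : ℤ, inner ℝ (v x) (v y) = n := fun x y => by
    rw [hv]
    exact E8InnerProduct_int _
  have heq : ∀ {x y}, E8InnerProduct (A.cls x y) = 2 → x = y := fun {x y} hxy =>
    (A.cls_eq_zero_iff x y).1 (E8InnerProduct_injective hxy)
  have hinj : Function.Injective v := fun x y hxy => heq (by rw [← hv, hxy, hself])
  obtain ⟨u, w, huw, hT⟩ := exists_orthogonal_pair h
  obtain ⟨e, he, hspan, he0, hei⟩ := exists_orthonormal_frame hself hint hinj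
    ((hv u w).trans huw) hT fun z hz => by
      rw [hv, hv]
      exact (Finset.mem_filter.1 hz).2
  -- The trace is 2|X| = 8c, so eight orthonormal vectors in the span exhaust it.
  have hpars := inner_eq_sum_of_tight_frame (n := 8) (v := v) (c := ∑ z ∈ E8Roots, z 0 * z 0)
    (fun x y => by simp only [hv, sum_E8InnerProduct_mul h])
    (by
      simp only [hself, Finset.sum_const, Finset.card_univ, card_eq_card_E8Roots h, nsmul_eq_mul]
      push_cast
      linarith) he hspan
  let p : X → EuclideanSpace ℝ (Fin 8) := fun x => WithLp.toLp 2 fun i => inner ℝ (e i) (v x)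
  have hinner : ∀ x y, inner ℝ (p x) (p y) = E8InnerProduct (A.cls x y) := by
    intro x y
    rw [inner_eq_sum_mul, ← hv, hpars]
  obtain ⟨s, hs, hmem⟩ := exists_scaleLast_mem (p := p)
    (fun x y => by rw [hinner]; exact E8InnerProduct_int _)
    (fun x => by rw [hinner, ← hv, hself]) he0 hei
  let f : X → E8MinimalVectors := fun x => ⟨scaleLast s (p x), hmem x⟩
  have hf : ∀ x y, E8Class (f x) (f y) = A.cls x y := by
    intro x y
    rw [E8Class_eq_iff, inner_scaleLast hs, hinner]
  have hfinj : Function.Injective f := by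
    intro x y hxy
    have hxx := hf x x
    rw [(A.cls_eq_zero_iff x x).2 rfl] at hxx
    rw [← A.cls_eq_zero_iff, ← hf, ← hxy, hxx]
  have hbij : Function.Bijective f := (Nat.bijective_iff_injective_and_card f).2 ⟨hfinj, h.size_eq⟩
  exact ⟨Equiv.ofBijective f hbij, hf⟩

theorem mainTheorem5 :
    ∃ E : AssociationScheme 4 E8MinimalVectors, IsE8Scheme E ∧
      ∀ (X : Type*) (A : AssociationScheme 4 X), A.SameParameters E → A.IsIsomorphic E :=
  ⟨E8Scheme, fun x y => (E8InnerProduct_E8Class x y).symm, fun _ _ h => isIsomorphic_E8Scheme h⟩
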